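/- Consider the HLV model: $n$ camera locations $t_1^*,\dots,t_n^*$ are drawn i.i.d. from $N(0,I)$ in $\mathbb{R}^3$; independently of them, a graph $G([n],E)$ is drawn from the Erdős–Rényi ensemble $G(n,p)$; a set $E_b\subseteq E$ of bad edges whose maximal degree is at most $n\epsilon_b$ is chosen arbitrarily; each edge $ij\in E\setminus E_b$ carries its true direction $\gamma_{ij}=\gamma_{ij}^*:=(t_i^*-t_j^*)/\|t_i^*-t_j^*\|$, and each bad edge an arbitrary direction $\gamma_{ij}\in S^2$. The graph $G([n],E)$ with vertex locations $t_1^*,\dots,t_n^*$ is called parallel rigid in $\mathbb{R}^3$ if the locations are distinct and are determined, up to scale and shift, by the edge directions: whenever $t_1',\dots,t_n'\in\mathbb{R}^3$ satisfy $(t_i'-t_j')/\|t_i'-t_j'\|=\gamma_{ij}^*$ for all $ij\in E$, there are $c>0$ and $s\in\mathbb{R}^3$ with $t_i'=ct_i^*+s$ for all $i$. **Proposition.** A graph generated by the HLV model with $p\gtrsim n^{-1/3}\log^{1/3}n$ and $\epsilon_b\lesssim p^{7/3}/\log^{9/2}n$ is parallel rigid in $\mathbb{R}^3$ with overwhelming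 probability. Precisely: there are absolute constants $\alpha,C>0$ such that for all $C_0,C_1>0$ there is $n_0$ such that for all $n>n_0$, all $p$ with $C_0n^{-1/3}\log^{1/3}n\le p\le 1$ and all $\epsilon_b\le C_1p^{7/3}/\log^{9/2}n$, the graph $G([n],E)$ with locations $t_1^*,\dots,t_n^*$ generated by the HLV model with parameters $n,p,\epsilon_b$ is parallel rigid in $\mathbb{R}^3$ with probability at least $1-e^{-Cn^{\alpha}}$. -/

import Mathlib

open MeasureTheory ProbabilityTheory
open scoped unitInterval

noncomputable section

/-- Euclidean space `ℝ³`. -/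
abbrev E3 : Type := EuclideanSpace ℝ (Fin 3)

/-- The direction from `y` to `x`: the unit vector `(x - y) / ‖x - y‖` (for `x ≠ y`). -/
def direction (x y : E3) : E3 := ‖x - y‖⁻¹ • (x - y)

/-- The graph `G` with vertex locations `t` is parallel rigid in `ℝ³`: the locations are distinct,
and they are the only ones, up to scale and shift, that have the same edge directions.
(A competitor `t'` is automatically noncoincident along the edges, since its edge directions are
required to equal unit vectors.) -/
def IsParallelRigid {n : ℕ} (G : SimpleGraph (Fin n)) (t : Fin n → E3) : Prop :=
  Function.Injective t ∧
    ∀ t' : Fin n → E3,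
      (∀ i j, G.Adj i j → direction (t' i) (t' j) = direction (t i) (t j)) →
        ∃ c : ℝ, 0 < c ∧ ∃ s : E3, ∀ i, t' i = c • t i + s

open scoped Classical in
/-- The corruption level of a set of bad edges (given as a graph on the cameras): the maximal degree
of the bad edges, divided by the number of cameras. -/
def corruptionLevel {n : ℕ} (B : SimpleGraph (Fin n)) : ℝ := (B.maxDegree : ℝ) / n

/-- The HLV model with parameters `n`, `p` and `εb`: random camera locations `t`, a random graph `G`
on the cameras, the random set of bad (corrupted) edges `B`, and random pairwise directions `γ`.
Edges are undirected, and `γ ω i j` is the direction attached to the edge `ij` when it is read from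
`j` to `i`. The bad edges and their directions are arbitrary: they may depend on everything else. -/
structure IsHLVModel {Ω : Type*} [MeasurableSpace Ω] (P : Measure Ω) (n : ℕ) (p : I) (εb : ℝ)
    (t : Fin n → Ω → E3) (G B : Ω → SimpleGraph (Fin n)) (γ : Ω → Fin n → Fin n → E3) : Prop where
  /-- Each location has law `N(0, I)`. -/
  location_law : ∀ i, HasLaw (t i) (stdGaussian E3) P
  /-- The locations are independent. -/
  location_indep : iIndepFun t P
  /-- The graph is an Erdős–Rényi graph `G(n, p)`. -/
  graph_law : HasLaw G (SimpleGraph.binomialRandom (Fin n) p) P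
  /-- The graph is drawn independently of the locations. -/
  graph_indep : IndepFun (fun ω i => t i ω) G P
  /-- The bad edges are edges. -/
  bad_le : ∀ ω, B ω ≤ G ω
  /-- The corruption level is at most `εb`. -/
  corruption_le : ∀ᵐ ω ∂P, corruptionLevel (B ω) ≤ εb
  /-- A good edge carries its true direction. -/
  good_direction : ∀ ω i j, (G ω).Adj i j → ¬ (B ω).Adj i j → γ ω i j = direction (t i ω) (t j ω)
  /-- A bad edge carries an arbitrary unit vector. -/
  bad_direction : ∀ ω i j, (B ω).Adj i j → ‖γ ω i j‖ = 1
  /-- There is one direction per undirected edge: reading the edge backwards changes the sign. -/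
  direction_symm : ∀ ω i j, (G ω).Adj i j → γ ω j i = -γ ω i j

end

/-!
In `ℝ³` a closed quadrilateral with affinely independent vertices is rigid: if its sides are
rescaled to `p' i - p' (i + 1) = r i • (p i - p (i + 1))`, summing around the cycle gives an affine
relation between the `p i` with weights `r i - r (i - 1)`, so all the `r i` agree. Independent
Gaussian locations are almost surely in general position. Hence, as soon as any two vertices have
two common neighbours, any two edges at a vertex lie on a rigid quadrilateral, and all edges are
rescaled by the same factor. A given pair of vertices has at most one common neighbour with
probability at most `n (1 - p²) ^ (n - 3)`, which stays stretched-exponentially small after a union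
bound over the pairs because `p² n` grows at least like a positive power of `n`.
-/

section GeneralPosition

variable {V E : Type*} [AddCommGroup E] [Module ℝ E]

/-- A family of points is in general position if any `k ≤ d + 1` of them are affinely independent,
where `d` is the dimension of the ambient space. The points are selected by an embedding, so that
they may be listed in any order. -/
def InGeneralPosition (t : V → E) : Prop :=
  ∀ k ≤ Module.finrank ℝ E + 1, ∀ f : Fin k ↪ V, AffineIndependent ℝ (t ∘ f)

theorem InGeneralPosition.injective {t : V → E} (ht : InGeneralPosition t)
    (hdim : 1 ≤ Module.finrank ℝ E) : Function.Injective t := by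
  intro i j hij
  by_contra hne
  have h := ht 2 (by omega) ⟨![i, j], by simpa [Function.Injective, Fin.forall_fin_two, eq_comm]⟩
  exact zero_ne_one (h.injective (a₁ := 0) (a₂ := 1) hij)

theorem ratio_add_one_eq_of_parallel_polygon {n : ℕ} [NeZero n] {p p' : Fin n → E} {r : Fin n → ℝ}
    (hp : AffineIndependent ℝ p)
    (h : ∀ i, p' i - p' (i + 1) = r i • (p i - p (i + 1))) (i : Fin n) : r (i + 1) = r i := by
  have sum_shift (q : Fin n → E) : ∑ i, q (i + 1) = ∑ i, q i := Equiv.sum_comp (Equiv.addRight 1) q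
  have weights_sum : ∑ i, (r i - r (i - 1)) = 0 := by
    rw [Finset.sum_sub_distrib, sub_eq_zero]
    exact (Equiv.sum_comp (Equiv.subRight 1) r).symm
  have relation : ∑ i, (r i - r (i - 1)) • p i = 0 := calc
    ∑ i, (r i - r (i - 1)) • p i = ∑ i, r i • p i - ∑ i, r i • p (i + 1) := by
      simp only [sub_smul, Finset.sum_sub_distrib]
      rw [← sum_shift fun i => r (i - 1) • p i]
      simp only [add_sub_cancel_right]
    _ = ∑ i, (p' i - p' (i + 1)) := by simp only [h, smul_sub, Finset.sum_sub_distrib]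
    _ = 0 := by rw [Finset.sum_sub_distrib, sum_shift, sub_self]
  have := hp.eq_zero_of_sum_eq_zero weights_sum relation (i + 1) (Finset.mem_univ _)
  rwa [add_sub_cancel_right, sub_eq_zero] at this

end GeneralPosition

section Rigidity

variable {V E : Type*} [AddCommGroup E] [Module ℝ E] {G : SimpleGraph V} {p p' : V → E}
  {r : Sym2 V → ℝ}

theorem ratio_eq_of_adj_adj (hp : InGeneralPosition p) (hdim : 3 ≤ Module.finrank ℝ E)
    (hG : Pairwise fun x y => (G.commonNeighbors x y).Nontrivial)
    (hr : ∀ x y, G.Adj x y → p' x - p' y = r s(x, y) • (p x - p y)) {v x y : V}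
    (hx : G.Adj v x) (hy : G.Adj v y) : r s(v, x) = r s(v, y) := by
  rcases eq_or_ne x y with rfl | hxy
  · rfl
  obtain ⟨u, ⟨(hxu : G.Adj x u), (hyu : G.Adj y u)⟩, huv⟩ := (hG hxy).exists_ne v
  have hinj : Function.Injective ![v, x, u, y] := by
    simp [Function.Injective, Fin.forall_fin_succ, hx.ne, hx.ne', hy.ne, hy.ne', hxy, hxy.symm,
      huv, huv.symm, hxu.ne, hxu.ne', hyu.ne, hyu.ne']
  have hsides : ∀ i, p' (![v, x, u, y] i) - p' (![v, x, u, y] (i + 1)) =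
      r s(![v, x, u, y] i, ![v, x, u, y] (i + 1)) •
        (p (![v, x, u, y] i) - p (![v, x, u, y] (i + 1))) := by
    refine fun i => hr _ _ ?_
    fin_cases i
    exacts [hx, hxu, hyu.symm, hy.symm]
  have h := ratio_add_one_eq_of_parallel_polygon (hp 4 (by omega) ⟨_, hinj⟩) hsides 3
  simpa [Sym2.eq_swap] using h

theorem ratio_eq_of_mem_edgeSet (hp : InGeneralPosition p) (hdim : 3 ≤ Module.finrank ℝ E)
    (hG : Pairwise fun x y => (G.commonNeighbors x y).Nontrivial)
    (hr : ∀ x y, G.Adj x y → p' x - p' y = r s(x, y) • (p x - p y)) {e f : Sym2 V}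
    (he : e ∈ G.edgeSet) (hf : f ∈ G.edgeSet) : r e = r f := by
  induction e with | _ a b
  induction f with | _ x y
  have star {v x y} := ratio_eq_of_adj_adj hp hdim hG hr (v := v) (x := x) (y := y)
  rcases eq_or_ne a x with rfl | hax
  · exact star he hf
  · obtain ⟨w, (haw : G.Adj a w), (hxw : G.Adj x w)⟩ := (hG hax).nonempty
    calc r s(a, b) = r s(a, w) := star he haw
      _ = r s(x, w) := by
        rw [Sym2.eq_swap (a := a), star haw.symm hxw.symm, Sym2.eq_swap]
      _ = r s(x, y) := star hxw hf

theorem exists_pos_forall_sub_eq_smul (hp : InGeneralPosition p) (hdim : 3 ≤ Module.finrank ℝ E)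
    (hG : Pairwise fun x y => (G.commonNeighbors x y).Nontrivial)
    (hr : ∀ x y, G.Adj x y → p' x - p' y = r s(x, y) • (p x - p y))
    (hpos : ∀ e ∈ G.edgeSet, 0 < r e) : ∃ c : ℝ, 0 < c ∧ ∀ x y, p' x - p' y = c • (p x - p y) := by
  rcases G.edgeSet.eq_empty_or_nonempty with hE | ⟨e, he⟩
  · refine ⟨1, one_pos, fun x y => ?_⟩
    rcases eq_or_ne x y with rfl | hxy
    · simp
    · obtain ⟨w, hxw, -⟩ := (hG hxy).nonempty
      exact absurd (G.mem_edgeSet.2 hxw) (by simp [hE])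
  · refine ⟨r e, hpos e he, fun x y => ?_⟩
    have hedge {x y} (hxy : G.Adj x y) : p' x - p' y = r e • (p x - p y) := by
      rw [hr x y hxy, ratio_eq_of_mem_edgeSet hp hdim hG hr (e := s(x, y)) hxy he]
    rcases eq_or_ne x y with rfl | hxy
    · simp
    · obtain ⟨w, (hxw : G.Adj x w), (hyw : G.Adj y w)⟩ := (hG hxy).nonempty
      rw [← sub_add_sub_cancel _ (p' w), hedge hxw, hedge hyw.symm, ← smul_add,
        sub_add_sub_cancel]

theorem exists_smul_add_of_forall_sub_eq_smul {c : ℝ}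
    (h : ∀ x y, p' x - p' y = c • (p x - p y)) : ∃ s, ∀ x, p' x = c • p x + s := by
  rcases isEmpty_or_nonempty V with hV | ⟨⟨o⟩⟩
  · exact ⟨0, fun x => hV.elim x⟩
  · refine ⟨p' o - c • p o, fun x => ?_⟩
    rw [sub_eq_iff_eq_add.1 (h x o)]
    module

end Rigidity

theorem sub_eq_smul_sub_of_direction_eq {x y x' y' : E3}
    (h : direction x' y' = direction x y) : x' - y' = (‖x' - y'‖ / ‖x - y‖) • (x - y) := by
  rw [div_eq_mul_inv, mul_smul]
  change _ = _ • direction x y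
  rw [← h, direction]
  by_cases h' : x' - y' = 0
  · simp [h']
  · rw [smul_inv_smul₀ (norm_ne_zero_iff.2 h')]

theorem direction_eq_zero {x y : E3} : direction x y = 0 ↔ x = y := by
  simp [direction, sub_eq_zero]

theorem InGeneralPosition.isParallelRigid {n : ℕ} {G : SimpleGraph (Fin n)} {t : Fin n → E3}
    (ht : InGeneralPosition t) (hG : Pairwise fun x y => (G.commonNeighbors x y).Nontrivial) :
    IsParallelRigid G t := by
  have hinj := ht.injective (by simp)
  refine ⟨hinj, fun t' ht' => ?_⟩
  let r : Sym2 (Fin n) → ℝ := Sym2.lift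
    ⟨fun i j => ‖t' i - t' j‖ / ‖t i - t j‖, fun i j => by simp only [norm_sub_rev]⟩
  have hr : ∀ i j, G.Adj i j → t' i - t' j = r s(i, j) • (t i - t j) :=
    fun i j hij => sub_eq_smul_sub_of_direction_eq (ht' i j hij)
  have hpos : ∀ e ∈ G.edgeSet, 0 < r e := by
    intro e he
    induction e with | _ i j
    have hne : t i ≠ t j := hinj.ne (G.ne_of_adj he)
    have hne' : t' i ≠ t' j := by
      rwa [Ne, ← direction_eq_zero, ht' i j he, direction_eq_zero]
    exact div_pos (norm_sub_pos_iff.2 hne') (norm_sub_pos_iff.2 hne)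
  obtain ⟨c, hc, h⟩ := exists_pos_forall_sub_eq_smul ht (by simp) hG hr hpos
  exact ⟨c, hc, exists_smul_add_of_forall_sub_eq_smul h⟩

theorem affineIndependent_fin_cons {K W : Type*} [DivisionRing K] [AddCommGroup W] [Module K W]
    {k : ℕ} {a : W} {x : Fin k → W} (hx : AffineIndependent K x)
    (ha : a ∉ affineSpan K (Set.range x)) :
    AffineIndependent K (Fin.cons a x : Fin (k + 1) → W) := by
  refine AffineIndependent.affineIndependent_of_notMem_span (i := 0) ?_ ?_
  · rw [← affineIndependent_equiv (finSuccAboveEquiv 0)]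
    exact hx
  · rwa [← Set.compl_singleton_eq, ← Fin.range_succ, ← Set.range_comp]

theorem affineSpan_range_fin_ne_top {K W : Type*} [DivisionRing K] [AddCommGroup W] [Module K W]
    {k : ℕ} (hk : k ≤ Module.finrank K W) (x : Fin k → W) :
    affineSpan K (Set.range x) ≠ ⊤ := by
  intro h
  rcases k with _ | k
  · simp at h
  · have hle := finrank_vectorSpan_range_le K x (Fintype.card_fin _)
    rw [← direction_affineSpan, h, AffineSubspace.direction_top, finrank_top] at hle
    omega

section AlmostSure

variable {E : Type*} [NormedAddCommGroup E] [NormedSpace ℝ E] [FiniteDimensional ℝ E]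
  [MeasurableSpace E] [BorelSpace E]

theorem ae_pi_affineIndependent {k : ℕ} (hk : k ≤ Module.finrank ℝ E + 1) (μ : Fin k → Measure E)
    [∀ i, SigmaFinite (μ i)] (hμ : ∀ i, ∀ S : AffineSubspace ℝ E, S ≠ ⊤ → μ i S = 0) :
    ∀ᵐ x ∂Measure.pi μ, AffineIndependent ℝ x := by
  induction k with
  | zero => exact .of_forall fun x => affineIndependent_of_subsingleton ℝ x
  | succ k ih =>
    have hmeas : MeasurableSet {x : Fin (k + 1) → E | AffineIndependent ℝ x} :=
      isOpen_setOfPred_affineIndependent.measurableSet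
    have hmp := (measurePreserving_piFinSuccAbove μ 0).symm
    have hmeas' : MeasurableSet {z | AffineIndependent ℝ
      ((MeasurableEquiv.piFinSuccAbove (fun _ => E) 0).symm z)} := hmp.measurable hmeas
    rw [← hmp.map_eq, ae_map_iff hmp.aemeasurable hmeas, Measure.ae_prod_iff_ae_ae hmeas',
      Measure.ae_ae_comm hmeas']
    filter_upwards [ih (by omega) (fun i => μ i.succ) fun i => hμ i.succ] with x hx
    have hspan := hμ 0 _ (affineSpan_range_fin_ne_top (by omega) x)
    filter_upwards [measure_eq_zero_iff_ae_notMem.1 hspan] with a ha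
    simpa [MeasurableEquiv.piFinSuccAbove, Fin.insertNthEquiv] using
      affineIndependent_fin_cons hx ha

variable {V Ω : Type*} [Countable V] [MeasurableSpace Ω] {P : Measure Ω} {X : V → Ω → E}

theorem ae_inGeneralPosition (hX : ∀ i, AEMeasurable (X i) P) (hindep : iIndepFun X P)
    (hnull : ∀ i, ∀ S : AffineSubspace ℝ E, S ≠ ⊤ → P.map (X i) S = 0) :
    ∀ᵐ ω ∂P, InGeneralPosition fun i => X i ω := by
  have := hindep.isProbabilityMeasure
  have (k : ℕ) : Countable (Fin k ↪ V) := DFunLike.coe_injective.countable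
  refine ae_all_iff.2 fun k => ?_
  rw [Filter.eventually_imp_distrib_left]
  intro hk
  refine ae_all_iff.2 fun f => ?_
  have hf := hindep.precomp f.injective
  have (i : Fin k) := Measure.isProbabilityMeasure_map (hX (f i))
  have h := ae_pi_affineIndependent hk (fun i => P.map (X (f i))) fun i => hnull (f i)
  rw [← hf.map_fun_eq_pi_map fun i => hX (f i)] at h
  exact ae_of_ae_map (aemeasurable_pi_lambda _ fun i => hX (f i)) h

end AlmostSure

theorem stdGaussian_affineSubspace_eq_zero {E : Type*} [NormedAddCommGroup E]
    [InnerProductSpace ℝ E] [FiniteDimensional ℝ E] [MeasurableSpace E] [BorelSpace E]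
    {S : AffineSubspace ℝ E} (hS : S ≠ ⊤) : stdGaussian E S = 0 := by
  rcases S.eq_bot_or_nonempty with rfl | ⟨a, ha⟩
  · simp
  have hdir : S.direction < ⊤ := lt_top_iff_ne_top.2 fun h =>
    hS ((AffineSubspace.direction_eq_top_iff_of_nonempty ⟨a, ha⟩).1 h)
  obtain ⟨f, hf, hker⟩ := Submodule.exists_le_ker_of_lt_top _ hdir
  let L : StrongDual ℝ E := f.toContinuousLinearMap
  have hsub : (S : Set E) ⊆ L ⁻¹' {L a} := fun x hx => by
    have := hker (S.vsub_mem_direction hx ha)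
    simpa [L, sub_eq_zero] using this
  have hnull : NullSingletonClass ((stdGaussian E).map L) := by
    rw [IsGaussian.map_eq_gaussianReal L]
    refine nullSingletonClass_gaussianReal ?_
    rw [variance_dual_stdGaussian, ne_eq, Real.toNNReal_eq_zero, not_le]
    have : 0 < ‖L‖ := norm_pos_iff.2 (by simpa [L] using hf)
    positivity
  refine measure_mono_null hsub ?_
  rw [← Measure.map_apply (by fun_prop) (measurableSet_singleton _), measure_singleton]

theorem IsHLVModel.ae_inGeneralPosition {Ω : Type*} [MeasurableSpace Ω] {P : Measure Ω} {n : ℕ}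
    {p : I} {εb : ℝ} {t : Fin n → Ω → E3} {G B : Ω → SimpleGraph (Fin n)}
    {γ : Ω → Fin n → Fin n → E3} (h : IsHLVModel P n p εb t G B γ) :
    ∀ᵐ ω ∂P, InGeneralPosition fun i => t i ω :=
  _root_.ae_inGeneralPosition (fun i => (h.location_law i).aemeasurable) h.location_indep
    fun i S hS => by
      rw [(h.location_law i).map_eq, stdGaussian_affineSubspace_eq_zero hS]

theorem measureReal_biInter_compl_of_iIndepSet {Ω ι : Type*} [MeasurableSpace Ω] {μ : Measure Ω}
    {f : ι → Set Ω} (hf : iIndepSet f μ) (s : Finset ι) :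
    μ.real (⋂ i ∈ s, (f i)ᶜ) = ∏ i ∈ s, μ.real (f i)ᶜ := by
  have h : μ (⋂ i ∈ s, (f i)ᶜ) = ∏ i ∈ s, μ (f i)ᶜ :=
    ((iIndepSet_iff_iIndep _ _).1 hf).meas_biInter fun i _ =>
      (MeasurableSpace.measurableSet_generateFrom (Set.mem_singleton (f i))).compl
  simp only [measureReal_def, h, ENNReal.toReal_prod]

section BinomialRandomGraph

open SimpleGraph

variable {V : Type*} (p : I)

theorem measurableSet_setOf_mem_commonNeighbors (x y u : V) :
    MeasurableSet {G : SimpleGraph V | u ∈ G.commonNeighbors x y} := by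
  simp only [mem_commonNeighbors]
  measurability

theorem setBernoulli_setOf_finset_subset {ι : Type*} {u : Set ι} {s : Finset ι}
    (hs : (s : Set ι) ⊆ u) :
    setBernoulli u p {S | (s : Set ι) ⊆ S} = (unitInterval.toNNReal p : ENNReal) ^ s.card := by
  have hpi : (fun q : ι → Prop => {i | q i}) ⁻¹' {S | (s : Set ι) ⊆ S} =
      (s : Set ι).pi fun _ => {True} := by
    ext q
    simp [Set.subset_def]
  rw [setBernoulli_apply', hpi, Measure.infinitePi_pi _ fun _ _ => .of_discrete]
  refine Finset.prod_eq_pow_card fun i hi => ?_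
  have hi' : i ∈ u := hs hi
  simp [hi']

variable [Countable V] {x y : V}

theorem binomialRandom_setOf_finset_subset_edgeSet {s : Finset (Sym2 V)}
    (hs : ∀ e ∈ s, ¬ e.IsDiag) :
    binomialRandom V p {G | (s : Set (Sym2 V)) ⊆ G.edgeSet} =
      (unitInterval.toNNReal p : ENNReal) ^ s.card := by
  have hs' : (s : Set (Sym2 V)) ⊆ Sym2.diagSetᶜ := hs
  have hpre : fromEdgeSet ⁻¹' {G : SimpleGraph V | (s : Set (Sym2 V)) ⊆ G.edgeSet} =
      {S | (s : Set (Sym2 V)) ⊆ S} := by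
    ext S
    simp only [Set.mem_preimage, Set.mem_ofPred_eq, edgeSet_fromEdgeSet, Set.subset_sdiff]
    exact and_iff_left (Set.disjoint_left.2 hs)
  have hmeas : MeasurableSet {G : SimpleGraph V | (s : Set (Sym2 V)) ⊆ G.edgeSet} := by
    simp only [Set.subset_def]
    measurability
  rw [binomialRandom_eq_map, Measure.map_apply measurable_fromEdgeSet hmeas, hpre,
    setBernoulli_setOf_finset_subset p hs']

theorem binomialRandom_setOf_subset_commonNeighbors (hxy : x ≠ y) {T : Finset V} (hx : x ∉ T)
    (hy : y ∉ T) :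
    binomialRandom V p {G | (T : Set V) ⊆ G.commonNeighbors x y} =
      (unitInterval.toNNReal p : ENNReal) ^ (2 * T.card) := by
  classical
  have hinj (v : V) : Function.Injective (fun u => s(v, u)) := fun _ _ => Sym2.congr_right.1
  have hcard : (T.image (s(x, ·)) ∪ T.image (s(y, ·))).card = 2 * T.card := by
    rw [Finset.card_union_of_disjoint, Finset.card_image_of_injective _ (hinj x),
      Finset.card_image_of_injective _ (hinj y), two_mul]
    simp only [Finset.disjoint_left, Finset.mem_image]
    grind [Sym2.eq_iff]
  rw [← hcard, ← binomialRandom_setOf_finset_subset_edgeSet]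
  · congr
    ext G
    simp [Set.subset_def, mem_commonNeighbors, or_imp, forall_and]
  · simp only [Finset.mem_union, Finset.mem_image]
    grind [Sym2.mk_isDiag_iff]

theorem binomialRandom_setOf_mem_commonNeighbors (hxy : x ≠ y) {u : V} (hx : u ≠ x) (hy : u ≠ y) :
    binomialRandom V p {G | u ∈ G.commonNeighbors x y} =
      (unitInterval.toNNReal p : ENNReal) ^ 2 := by
  simpa using binomialRandom_setOf_subset_commonNeighbors p hxy (T := {u}) (by simpa using hx.symm)
    (by simpa using hy.symm)

theorem iIndepSet_mem_commonNeighbors (hxy : x ≠ y) :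
    iIndepSet (fun u : {u // u ≠ x ∧ u ≠ y} => {G : SimpleGraph V | ↑u ∈ G.commonNeighbors x y})
      (binomialRandom V p) := by
  classical
  refine (iIndepSet_iff_meas_biInter fun u => measurableSet_setOf_mem_commonNeighbors x y _).2
    fun T => ?_
  have hT := binomialRandom_setOf_subset_commonNeighbors p hxy (T := T.map (.subtype _)) (by simp)
    (by simp)
  rw [Finset.card_map] at hT
  rw [Finset.prod_eq_pow_card fun u _ =>
    binomialRandom_setOf_mem_commonNeighbors p hxy u.2.1 u.2.2, ← pow_mul, ← hT]
  congr
  ext G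
  simp [Set.subset_def]

theorem binomialRandom_real_disjoint_commonNeighbors (hxy : x ≠ y) {T : Finset V} (hx : x ∉ T)
    (hy : y ∉ T) :
    (binomialRandom V p).real {G | Disjoint (T : Set V) (G.commonNeighbors x y)} =
      (1 - p ^ 2) ^ T.card := by
  classical
  have hT : ∀ u ∈ T, u ≠ x ∧ u ≠ y := fun u hu =>
    ⟨ne_of_mem_of_not_mem hu hx, ne_of_mem_of_not_mem hu hy⟩
  have hcompl (u : {u // u ≠ x ∧ u ≠ y}) :
      (binomialRandom V p).real {G | ↑u ∈ G.commonNeighbors x y}ᶜ = 1 - p ^ 2 := by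
    rw [probReal_compl_eq_one_sub (measurableSet_setOf_mem_commonNeighbors x y _), measureReal_def,
      binomialRandom_setOf_mem_commonNeighbors p hxy u.2.1 u.2.2]
    simp
  have hset : {G : SimpleGraph V | Disjoint (T : Set V) (G.commonNeighbors x y)} =
      ⋂ u ∈ T.subtype fun u => u ≠ x ∧ u ≠ y, {G | ↑u ∈ G.commonNeighbors x y}ᶜ := by
    ext G
    simp only [Set.disjoint_left, Set.mem_ofPred_eq, Set.mem_iInter, Finset.mem_subtype,
      Set.mem_compl_iff, Subtype.forall, Finset.mem_coe]
    grind
  rw [hset, measureReal_biInter_compl_of_iIndepSet (iIndepSet_mem_commonNeighbors p hxy),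
    Finset.prod_eq_pow_card fun u _ => hcompl u, Finset.card_subtype, Finset.filter_true_of_mem hT]

end BinomialRandomGraph

section UnionBound

open SimpleGraph

variable {V : Type*} [Fintype V] {x y : V} (p : I)

theorem binomialRandom_real_commonNeighbors_subset_singleton_le (hxy : x ≠ y) (v : V) :
    (binomialRandom V p).real {G | G.commonNeighbors x y ⊆ {v}} ≤
      (1 - p ^ 2 : ℝ) ^ (Fintype.card V - 3) := by
  classical
  have hp : (0 : ℝ) ≤ 1 - p ^ 2 := sub_nonneg.2 (pow_le_one₀ p.2.1 p.2.2)
  have hcard : Fintype.card V - 3 ≤ ({x, y, v}ᶜ : Finset V).card := by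
    rw [Finset.card_compl]
    exact Nat.sub_le_sub_left Finset.card_le_three _
  calc
    _ ≤ (binomialRandom V p).real
        {G | Disjoint (({x, y, v}ᶜ : Finset V) : Set V) (G.commonNeighbors x y)} := by
      refine measureReal_mono fun G hG => Set.disjoint_right.2 fun u hu => ?_
      simp [hG hu]
    _ = (1 - p ^ 2) ^ ({x, y, v}ᶜ : Finset V).card :=
      binomialRandom_real_disjoint_commonNeighbors p hxy (by simp) (by simp)
    _ ≤ (1 - p ^ 2) ^ (Fintype.card V - 3) :=
      pow_le_pow_of_le_one hp (sub_le_self _ (sq_nonneg _)) hcard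

variable (V) in
theorem binomialRandom_real_not_pairwise_nontrivial_commonNeighbors_le :
    (binomialRandom V p).real {G | ¬ Pairwise fun x y => (G.commonNeighbors x y).Nontrivial} ≤
      (Fintype.card V : ℝ) ^ 3 * (1 - p ^ 2 : ℝ) ^ (Fintype.card V - 3) := by
  have hp : (0 : ℝ) ≤ 1 - p ^ 2 := sub_nonneg.2 (pow_le_one₀ p.2.1 p.2.2)
  let bad (τ : V × V × V) : Set (SimpleGraph V) :=
    {G | τ.1 ≠ τ.2.1 ∧ G.commonNeighbors τ.1 τ.2.1 ⊆ {τ.2.2}}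
  have hbad τ : (binomialRandom V p).real (bad τ) ≤ (1 - p ^ 2) ^ (Fintype.card V - 3) := by
    by_cases hτ : τ.1 = τ.2.1
    · simp [bad, hτ, pow_nonneg hp]
    · simpa [bad, hτ] using binomialRandom_real_commonNeighbors_subset_singleton_le p hτ τ.2.2
  calc
    _ ≤ (binomialRandom V p).real (⋃ τ, bad τ) := by
      refine measureReal_mono fun G hG => ?_
      simp only [Pairwise, not_forall, Set.not_nontrivial_iff, Set.mem_ofPred_eq] at hG
      obtain ⟨x, y, hxy, hsub⟩ := hG
      rcases hsub.eq_empty_or_singleton with h | ⟨v, h⟩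
      · exact Set.mem_iUnion.2 ⟨(x, y, x), hxy, h.trans_subset (Set.empty_subset _)⟩
      · exact Set.mem_iUnion.2 ⟨(x, y, v), hxy, h.subset⟩
    _ ≤ ∑ τ, (binomialRandom V p).real (bad τ) := measureReal_iUnion_fintype_le _
    _ ≤ ∑ _τ : V × V × V, (1 - p ^ 2 : ℝ) ^ (Fintype.card V - 3) :=
      Finset.sum_le_sum fun τ _ => hbad τ
    _ = (Fintype.card V : ℝ) ^ 3 * (1 - p ^ 2 : ℝ) ^ (Fintype.card V - 3) := by
      simp [pow_succ, mul_assoc]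

end UnionBound

section Asymptotics

open Filter

theorem one_sub_pow_le_exp {x : ℝ} (hx : x ≤ 1) (n : ℕ) : (1 - x) ^ n ≤ Real.exp (-(x * n)) := by
  rw [← neg_mul, mul_comm, Real.exp_nat_mul]
  exact pow_le_pow_left₀ (sub_nonneg.2 hx) (Real.one_sub_le_exp_neg x) n

theorem isLittleO_rpow_rpow_atTop {a b : ℝ} (hab : a < b) :
    (fun x : ℝ => x ^ a) =o[atTop] fun x => x ^ b := by
  refine (Asymptotics.isLittleO_iff_tendsto' ?_).2 ?_
  · filter_upwards [eventually_gt_atTop 0] with x hx h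
    exact absurd h (Real.rpow_pos_of_pos hx b).ne'
  · refine (tendsto_rpow_neg_atTop (sub_pos.2 hab)).congr' ?_
    filter_upwards [eventually_gt_atTop 0] with x hx
    rw [neg_sub, Real.rpow_sub hx]

theorem eventually_three_log_add_rpow_le {α γ c : ℝ} (hγ : 0 < γ) (hα : α < γ) (hc : 0 < c) :
    ∀ᶠ x : ℝ in atTop, 3 * Real.log x + x ^ α ≤ c * x ^ γ := by
  have hlog := ((isLittleO_log_rpow_atTop hγ).const_mul_left 3).add
    (isLittleO_rpow_rpow_atTop hα)
  filter_upwards [hlog.bound hc, eventually_ge_atTop 0] with x hx h0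
  rw [Real.norm_eq_abs, Real.norm_of_nonneg (Real.rpow_nonneg h0 γ)] at hx
  exact (le_abs_self _).trans hx

theorem eventually_rpow_neg_le_mul_rpow_log {β β' C : ℝ} (hβ : β < β') (hC : 0 < C) (κ : ℝ) :
    ∀ᶠ x : ℝ in atTop, x ^ (-β') ≤ C * x ^ (-β) * Real.log x ^ κ := by
  filter_upwards [(isLittleO_log_rpow_rpow_atTop (-κ) (sub_pos.2 hβ)).bound hC,
    eventually_gt_atTop 1] with x hx h1
  have hx0 : 0 < x := one_pos.trans h1
  have hlog : 0 < Real.log x := Real.log_pos h1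
  rw [Real.norm_of_nonneg (by positivity), Real.norm_of_nonneg (by positivity)] at hx
  calc x ^ (-β') = Real.log x ^ (-κ) * (x ^ (-β') * Real.log x ^ κ) := by
        rw [mul_left_comm, ← Real.rpow_add hlog, neg_add_cancel, Real.rpow_zero, mul_one]
    _ ≤ C * x ^ (β' - β) * (x ^ (-β') * Real.log x ^ κ) := by gcongr
    _ = C * x ^ (-β) * Real.log x ^ κ := by
        rw [← mul_assoc, mul_assoc C, ← Real.rpow_add hx0]
        ring_nf

theorem eventually_cube_mul_one_sub_sq_pow_le {α β : ℝ} (hβ : β < 1 / 2) (hα : α < 1 - 2 * β) :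
    ∀ᶠ n : ℕ in atTop, ∀ p : ℝ, (n : ℝ) ^ (-β) ≤ p → p ≤ 1 →
      (n : ℝ) ^ 3 * (1 - p ^ 2) ^ (n - 3) ≤ Real.exp (-(n : ℝ) ^ α) := by
  have hexp := tendsto_natCast_atTop_atTop.eventually
    (eventually_three_log_add_rpow_le (by linarith) hα (show (0 : ℝ) < 1 / 4 by positivity))
  filter_upwards [hexp, eventually_ge_atTop 4] with n hn hn4 p hp hp1
  have hn0 : (0 : ℝ) < n := by positivity
  have hp0 : 0 ≤ p := le_trans (by positivity) hp
  have hsub : (n : ℝ) / 4 ≤ (n - 3 : ℕ) := by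
    rw [Nat.cast_sub (by omega)]
    have : (4 : ℝ) ≤ n := mod_cast hn4
    push_cast
    linarith
  have hrate : 1 / 4 * (n : ℝ) ^ (1 - 2 * β) ≤ p ^ 2 * (n - 3 : ℕ) := calc
    1 / 4 * (n : ℝ) ^ (1 - 2 * β) = ((n : ℝ) ^ (-β)) ^ 2 * (n / 4) := by
      rw [← Real.rpow_mul_natCast hn0.le, sub_eq_neg_add, Real.rpow_add_one hn0.ne']
      ring_nf
    _ ≤ p ^ 2 * (n - 3 : ℕ) := by gcongr
  calc
    (n : ℝ) ^ 3 * (1 - p ^ 2) ^ (n - 3)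
      ≤ Real.exp (3 * Real.log n) * Real.exp (-(p ^ 2 * (n - 3 : ℕ))) := by
        rw [mul_comm 3, Real.exp_mul, Real.exp_log hn0]
        norm_cast
        gcongr
        exact one_sub_pow_le_exp (pow_le_one₀ hp0 hp1) _
    _ ≤ Real.exp (-(n : ℝ) ^ α) := by
      rw [← Real.exp_add]
      gcongr
      linarith

end Asymptotics

theorem exists_measurableSet_of_measureReal_not_le {Ω : Type*} [MeasurableSpace Ω] {P : Measure Ω}
    [IsProbabilityMeasure P] {q : Ω → Prop} {δ : ℝ} (h : P.real {ω | ¬ q ω} ≤ δ) :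
    ∃ A, MeasurableSet A ∧ 1 - δ ≤ P.real A ∧ ∀ ω ∈ A, q ω := by
  refine ⟨(toMeasurable P {ω | ¬ q ω})ᶜ, (measurableSet_toMeasurable _ _).compl, ?_,
    fun ω hω => ?_⟩
  · rw [probReal_compl_eq_one_sub (measurableSet_toMeasurable _ _), measureReal_def,
      measure_toMeasurable, ← measureReal_def]
    linarith
  · by_contra hq
    exact hω (subset_toMeasurable P _ hq)

theorem measurableSet_of_finite_vertices {V : Type*} [Finite V] (S : Set (SimpleGraph V)) :
    MeasurableSet S :=
  SimpleGraph.measurableEmbedding_edgeSet.measurableSet_image.1 (Set.toFinite _).measurableSet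

theorem measureReal_not_isParallelRigid_le {Ω : Type*} [MeasurableSpace Ω] {P : Measure Ω}
    [IsFiniteMeasure P] {n : ℕ} {p : I} {t : Fin n → Ω → E3} {G : Ω → SimpleGraph (Fin n)}
    (ht : ∀ᵐ ω ∂P, InGeneralPosition fun i => t i ω)
    (hG : HasLaw G (SimpleGraph.binomialRandom (Fin n) p) P) :
    P.real {ω | ¬ IsParallelRigid (G ω) fun i => t i ω} ≤ (n : ℝ) ^ 3 * (1 - p ^ 2) ^ (n - 3) := by
  let S : Set (SimpleGraph (Fin n)) :=
    {G | ¬ Pairwise fun x y => (G.commonNeighbors x y).Nontrivial}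
  calc
    P.real {ω | ¬ IsParallelRigid (G ω) fun i => t i ω} ≤ P.real (G ⁻¹' S) := by
      refine ENNReal.toReal_mono (measure_ne_top _ _) (measure_mono_ae ?_)
      filter_upwards [ht] with ω hω hrigid hpair
      exact hrigid (hω.isParallelRigid hpair)
    _ = (SimpleGraph.binomialRandom (Fin n) p).real S := by
      exact hG.measureReal_eq (measurableSet_of_finite_vertices S)
    _ ≤ (n : ℝ) ^ 3 * (1 - p ^ 2) ^ (n - 3) := by
      simpa using binomialRandom_real_not_pairwise_nontrivial_commonNeighbors_le (Fin n) p

theorem propositionA1_general {α β C₀ : ℝ} (hβ : β < 1 / 2) (hα : α < 1 - 2 * β) (hC₀ : 0 < C₀)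
    (κ : ℝ) :
    ∃ n₀ : ℕ, ∀ n : ℕ, n₀ < n → ∀ p : I, C₀ * (n : ℝ) ^ (-β) * Real.log n ^ κ ≤ p →
      ∀ (Ω : Type*) [MeasurableSpace Ω] (P : Measure Ω) [IsProbabilityMeasure P]
        (t : Fin n → Ω → E3) (G : Ω → SimpleGraph (Fin n)),
        (∀ᵐ ω ∂P, InGeneralPosition fun i => t i ω) →
        HasLaw G (SimpleGraph.binomialRandom (Fin n) p) P →
          ∃ A : Set Ω, MeasurableSet A ∧ 1 - Real.exp (-(n : ℝ) ^ α) ≤ P.real A ∧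
            ∀ ω ∈ A, IsParallelRigid (G ω) fun i => t i ω := by
  obtain ⟨β', hββ', hβ'⟩ : ∃ β', β < β' ∧ β' < min (1 / 2) ((1 - α) / 2) :=
    exists_between (lt_min hβ (by linarith))
  obtain ⟨hβ'_half, hβ'_α⟩ := lt_min_iff.1 hβ'
  obtain ⟨n₀, hn₀⟩ := Filter.eventually_atTop.1 <|
    (tendsto_natCast_atTop_atTop.eventually (eventually_rpow_neg_le_mul_rpow_log hββ' hC₀ κ)).and
      (eventually_cube_mul_one_sub_sq_pow_le hβ'_half (by linarith : α < 1 - 2 * β'))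
  refine ⟨n₀, fun n hn p hp Ω _ P _ t G ht hG => exists_measurableSet_of_measureReal_not_le ?_⟩
  obtain ⟨hthreshold, hbound⟩ := hn₀ n hn.le
  exact (measureReal_not_isParallelRigid_le ht hG).trans
    (hbound p (hthreshold.trans hp) p.2.2)

theorem propositionA1 :
    ∃ α : ℝ, 0 < α ∧ ∃ C : ℝ, 0 < C ∧
      ∀ C₀ : ℝ, 0 < C₀ → ∀ C₁ : ℝ, 0 < C₁ → ∃ n₀ : ℕ,
        ∀ n : ℕ, n₀ < n → ∀ (p : unitInterval) (εb : ℝ),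
          C₀ * (n : ℝ) ^ (-(1 / 3) : ℝ) * (Real.log n) ^ (1 / 3 : ℝ) ≤ (p : ℝ) →
          εb ≤ C₁ * (p : ℝ) ^ (7 / 3 : ℝ) / (Real.log n) ^ (9 / 2 : ℝ) →
          ∀ (Ω : Type*) [MeasurableSpace Ω] (P : Measure Ω) [IsProbabilityMeasure P]
            (t : Fin n → Ω → E3) (G B : Ω → SimpleGraph (Fin n)) (γ : Ω → Fin n → Fin n → E3),
            IsHLVModel P n p εb t G B γ →
              ∃ A : Set Ω, MeasurableSet A ∧
                1 - Real.exp (-(C * (n : ℝ) ^ α)) ≤ P.real A ∧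
                ∀ ω ∈ A, IsParallelRigid (G ω) (fun i => t i ω) := by
  refine ⟨1 / 6, by norm_num, 1, one_pos, fun C₀ hC₀ _ _ => ?_⟩
  obtain ⟨n₀, hn₀⟩ :=
    propositionA1_general (α := 1 / 6) (β := 1 / 3) (by norm_num) (by norm_num) hC₀ (1 / 3)
  refine ⟨n₀, fun n hn p _ hp _ Ω _ P _ t G _ _ h => ?_⟩
  simpa only [one_mul] using hn₀ n hn p hp Ω P t G h.ae_inGeneralPosition h.graph_law
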